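/- Let $q$ be a prime power. For vectors $x,y\in\mathbb F_{q^2}^N$, where $x$ has pairwise distinct entries and $y$ has nonzero entries, let $\mathcal A_\ell(x,y)=\{c\in\mathbb F_q^N:\ \sum_i c_i\,y_i\,p(x_i)=0\text{ for all }p\in\mathbb F_{q^2}[z],\ \deg p<\ell\}$ be the alternant code of degree $\ell$, and for $\Gamma\in\mathbb F_{q^2}[z]$ without zeros among the entries of $x$ let $\Gamma(x)^{-1}=(\Gamma(x_i)^{-1})_i$ and let $\mathcal G(x,\Gamma)=\mathcal A_{\deg\Gamma}(x,\Gamma(x)^{-1})$ be the Goppa code over $\mathbb F_q$. Let $x\in\mathbb F_{q^2}^n$ have pairwise distinct entries, let $\gamma\in\mathbb F_{q^2}[z]$ be irreducible of degree $r>1$, and let $G$ be a generator matrix, with entries in $\mathbb F_q$, of the wild Goppa code $\mathcal C=\mathcal G(x,\gamma^{q-1})$ (the public code). Let $\sigma$ be a permutation of the $n$ positions such that the permuted support has the form $$x^\sigma=(u_0,\dots,u_{\ell_1-1},\,v_0,v_0^q,\dots,v_{\ell_2-1},v_{\ell_2-1}^q,\,w_0,\dots,w_{\ell_3-1}),$$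 where the $u_i$ are the entries of $x$ in $\mathbb F_q$, the $v_i,v_i^q$ are the entries in $\mathbb F_{q^2}\setminus\mathbb F_q$ whose conjugate is also an entry of $x$, and the $w_i$ are the entries in $\mathbb F_{q^2}\setminus\mathbb F_q$ whose conjugate is not an entry of $x$. Let $G^\sigma$ be $G$ with its columns permuted in the same way. Put $$x^\sigma_{\mathrm{ext}}=(u_0,\dots,u_{\ell_1-1},\,v_0,v_0^q,\dots,v_{\ell_2-1},v_{\ell_2-1}^q,\,w_0,w_0^q,\dots,w_{\ell_3-1},w_{\ell_3-1}^q),$$ let $G^\sigma_{\mathrm{ext}}$ be the matrix obtained from $G^\sigma$ by inserting a zero column at each position of an inserted $w_i^q$, and let $\mathcal C^\sigma_{\mathrm{ext}}\subseteq\mathbb F_q^{\,n+\ell_3}$ be the code generated by the rows of $G^\sigma_{\mathrm{ext}}$. Let $$x'_{\mathrm{ext}}=(u_0,\dots,u_{\ell_1-1},\,v'_0,v_0'^{\,q},\dots,v'_{\ell_2-1},v_{\ell_2-1}'^{\,q},\,w'_0,w_0'^{\,q},\dots,w'_{\ell_3-1},w_{\ell_3-1}'^{\,q})$$ be any vector of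 this form each of whose entries has the same minimal polynomial over $\mathbb F_q$ as the corresponding entry of $x^\sigma_{\mathrm{ext}}$. Let $\mathfrak T$ be the group of permutations of the $n+\ell_3$ positions that are products of disjoint transpositions, each of which exchanges the two positions of one of the pairs $(v_i,v_i^q)$ or $(w_i,w_i^q)$ of $x^\sigma_{\mathrm{ext}}$. Then there exist $\tau\in\mathfrak T$, with permutation matrix $R_\tau$, and an invertible diagonal matrix $D$ over $\mathbb F_q$ such that $M=R_\tau D$ satisfies $$\mathcal C^\sigma_{\mathrm{ext}}\,M\ \subseteq\ \mathcal A_{r(q+1)}(x'_{\mathrm{ext}},\mathbf 1),$$ where $\mathbf 1$ is the all-ones vector. -/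

import Mathlib

open Polynomial

noncomputable section

/-! Codes of length `|ι|` are linear subspaces of `ι → F`. In what follows `F` plays the role of
`𝔽_q` and `K` that of the quadratic extension `𝔽_{q²}`. -/

section Codes

variable {ι κ κ' F K : Type*} [Field F] [Field K] [Algebra F K]

/-- The generalized Reed-Solomon code `{(y_i p(x_i))_i : p ∈ K[z], deg p < k}`. -/
def grs (k : ℕ) (x y : ι → K) : Submodule K (ι → K) :=
  (degreeLT K k).map
    (LinearMap.pi fun i => y i • (Polynomial.leval (x i) : K[X] →ₗ[K] K))

/-- The dual of a code for the standard bilinear form. -/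
def dualCode [Fintype ι] (C : Submodule K (ι → K)) : Submodule K (ι → K) where
  carrier := {c | ∀ d ∈ C, ∑ i, c i * d i = 0}
  zero_mem' := by intro d _; simp
  add_mem' := by
    intro a b ha hb d hd
    simp [add_mul, Finset.sum_add_distrib, ha d hd, hb d hd]
  smul_mem' := by
    intro t a ha d hd
    simp [mul_assoc, ← Finset.mul_sum, ha d hd]

variable (F) in
/-- The subfield subcode `C ∩ F^ι` of a code `C ⊆ K^ι`. -/
def subfieldSubcode (C : Submodule K (ι → K)) : Submodule F (ι → F) :=
  (C.restrictScalars F).comap ((Algebra.linearMap F K).compLeft ι)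

variable (F) in
/-- The alternant code over `F` of degree `l`, with support `x` and multiplier `y`. -/
def alternant [Fintype ι] (l : ℕ) (x y : ι → K) : Submodule F (ι → F) :=
  subfieldSubcode F (dualCode (grs l x y))

variable (F) in
/-- The classical Goppa code over `F` with support `x` and Goppa polynomial `Γ`
(meant for `Γ` without zeros among the entries of `x`). -/
def goppa [Fintype ι] (x : ι → K) (Γ : K[X]) : Submodule F (ι → F) :=
  alternant F Γ.natDegree x fun i => (Γ.eval (x i))⁻¹

/-- The code generated by the rows of a matrix `G`. -/
def rowCode [Fintype κ] (G : Matrix κ ι F) : Submodule F (ι → F) :=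
  LinearMap.range G.vecMulLinear

/-- The code `C M = {c M : c ∈ C}`. -/
def codeMul [Fintype ι] (C : Submodule F (ι → F)) (M : Matrix ι κ' F) :
    Submodule F (κ' → F) :=
  C.map M.vecMulLinear

end Codes

section Positions

variable {κ F K : Type*} [Field F] [Field K] [Algebra F K] {l₁ l₂ l₃ : ℕ}

/-- Positions of `(u_0, …, v_0, v_0^q, v_1, v_1^q, …, w_0, w_1, …)`: a block of `l₁` positions `u_i`,
`l₂` pairs of positions for `v_i, v_i^q`, and `l₃` positions `w_i`. -/
abbrev SortedPos (l₁ l₂ l₃ : ℕ) : Type := Fin l₁ ⊕ ((Fin l₂ × Fin 2) ⊕ Fin l₃)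

/-- Positions of the extended vector
`(u_0, …, v_0, v_0^q, v_1, v_1^q, …, w_0, w_0^q, w_1, w_1^q, …)`: a block of `l₁` positions `u_i`,
followed by `l₂ + l₃` pairs. There are `(l₁ + 2 l₂ + l₃) + l₃` of them. -/
abbrev ExtPos (l₁ l₂ l₃ : ℕ) : Type := Fin l₁ ⊕ ((Fin l₂ ⊕ Fin l₃) × Fin 2)

variable (F) in
/-- The vector `y` has the form `(u_0, …, v_0, v_0^q, …, w_0, …)`, where the `u_i` lie in `F = 𝔽_q`,
the `v_i`, `v_i^q` and `w_i` lie outside `F`, and the conjugate `w_i^q` is not an entry of `y`. -/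
structure IsSorted (q : ℕ) (y : SortedPos l₁ l₂ l₃ → K) : Prop where
  u_mem : ∀ i, y (.inl i) ∈ Set.range (algebraMap F K)
  v_notMem : ∀ i b, y (.inr (.inl (i, b))) ∉ Set.range (algebraMap F K)
  v_conj : ∀ i, y (.inr (.inl (i, 1))) = y (.inr (.inl (i, 0))) ^ q
  w_notMem : ∀ i, y (.inr (.inr i)) ∉ Set.range (algebraMap F K)
  w_conj : ∀ i p, y p ≠ y (.inr (.inr i)) ^ q

/-- The extended support: insert the conjugate `w_i^q` after each `w_i`. -/
def extSupport (q : ℕ) (y : SortedPos l₁ l₂ l₃ → K) : ExtPos l₁ l₂ l₃ → K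
  | .inl i => y (.inl i)
  | .inr (.inl i, b) => y (.inr (.inl (i, b)))
  | .inr (.inr i, b) => if b = 0 then y (.inr (.inr i)) else y (.inr (.inr i)) ^ q

/-- The extended matrix: insert a zero column after each column at a position `w_i`. -/
def extMatrix (G : Matrix κ (SortedPos l₁ l₂ l₃) F) : Matrix κ (ExtPos l₁ l₂ l₃) F :=
  fun a p => match p with
  | .inl i => G a (.inl i)
  | .inr (.inl i, b) => G a (.inr (.inl (i, b)))
  | .inr (.inr i, b) => if b = 0 then G a (.inr (.inr i)) else 0

variable (F) in
/-- The vector `z` agrees with `e` up to Galois conjugation: it has the form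
`(u_0, …, v'_0, v'_0^q, …, w'_0, w'_0^q, …)`, and corresponding entries of `z` and `e` have the same
minimal polynomial over `F`. -/
structure IsGaloisVariant (q : ℕ) (e z : ExtPos l₁ l₂ l₃ → K) : Prop where
  minpoly_eq : ∀ p, minpoly F (z p) = minpoly F (e p)
  conj : ∀ j, z (.inr (j, 1)) = z (.inr (j, 0)) ^ q

variable (l₁ l₂ l₃) in
/-- The group of products of transpositions, each of which exchanges the two positions of one of the
pairs `v_i, v_i^q` or `w_i, w_i^q`. -/
def pairSwaps : Subgroup (Equiv.Perm (ExtPos l₁ l₂ l₃)) :=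
  Subgroup.closure
    (Set.range fun j : Fin l₂ ⊕ Fin l₃ => Equiv.swap (Sum.inr (j, 0)) (Sum.inr (j, 1)))

end Positions

end

/-! Write `N(a) = a ^ (q + 1)` for the norm from `K = 𝔽_{q²}` to `F = 𝔽_q`. The heart of the matter is
the inclusion `𝒢(x, γ ^ (q - 1)) ⊆ 𝒜_{r(q+1)}(x, γ(x) ^ (-(q + 1)))`, whose multiplier consists of
elements `N(γ(x_i))⁻¹` of `F`. Granting it, a codeword extended by zeros satisfies the same parity checks
on the extended support; an invertible diagonal matrix over `F` removes the multiplier; and since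
elements of `K` with the same minimal polynomial over `F` are equal or conjugate, `x'` is the extended
support with the two entries of some pairs exchanged, which is undone by some `τ`.

For the inclusion, fix a codeword `c` and put `S_m(f) = ∑ c_i f(x_i) / γ(x_i) ^ m`. As the `c_i` lie in
`F`, the Frobenius map `t ↦ t ^ q` may be applied under the sum. If `S_m` vanishes in degrees below
`r m`, then `S_{m+1}(f)`, for `f` of degree below `r (m + 1)`, depends only on `f` modulo `γ`.

* From `q - 1` to `q` (`mem_alternant_pow_card`): modulo `γ` every `f` is a power `h ^ q` with
  `deg h < r`, and `S_q(h ^ q) = S_1(h) ^ q = 0`.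
* From `q` to `q + 1` (`mem_alternant_pow_card_add_one`): now `γ(x_i) ^ (q + 1)` is fixed by Frobenius
  and `x_i ^ (q²) = x_i`. As `r > 1`, the polynomial `X ^ (q²) - X` is invertible modulo `γ`, so every
  `f` is congruent to `h ^ q (X ^ (q²) - X)` for some `h` of degree below `r`. Let `ρ` be the remainder of
  `h X ^ q` modulo `γ`. Then `f` is congruent to `ρ ^ q - h ^ q X`, and for `S = S_{q+1}`
  `S(ρ ^ q) = S(ρ) ^ q = S(h X ^ q) ^ q = S(h ^ q X)`, so that `S(f) = 0`. -/

section GoppaInclusion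

variable {ι F K : Type*} [Field F] [Field K] [Algebra F K]

/-! ### Parity checks of alternant codes -/

theorem mem_alternant_iff [Fintype ι] {l : ℕ} (hl : 0 < l) {x y : ι → K} {c : ι → F} :
    c ∈ alternant F l x y ↔
      ∀ p : K[X], p.natDegree < l → ∑ i, algebraMap F K (c i) * (y i * p.eval (x i)) = 0 := by
  have h : c ∈ alternant F l x y ↔
      ∀ d ∈ grs l x y, ∑ i, algebraMap F K (c i) * d i = 0 := Iff.rfl
  rw [h]
  simp only [grs, Submodule.mem_map, mem_degreeLT, forall_exists_index, and_imp,
    forall_apply_eq_imp_iff₂]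
  refine forall_congr' fun p => ?_
  have hdeg : p.degree < l ↔ p.natDegree < l := by
    rcases eq_or_ne p 0 with rfl | hp
    · simpa using hl
    · exact (natDegree_lt_iff_degree_lt hp).symm
  rw [hdeg]
  rfl

theorem sum_mul_pow_card [Fintype F] [Fintype ι] (c : ι → F) (g : ι → K) :
    (∑ i, algebraMap F K (c i) * g i) ^ Fintype.card F =
      ∑ i, algebraMap F K (c i) * g i ^ Fintype.card F := by
  have h := map_sum (FiniteField.frobeniusAlgHom F K)
    (fun i => algebraMap F K (c i) * g i) Finset.univ
  simpa only [FiniteField.coe_frobeniusAlgHom, mul_pow, ← map_pow, FiniteField.pow_card] using h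

/-! ### Reduction modulo an irreducible polynomial over a finite field -/

theorem exists_natDegree_lt_dvd_sub_pow_card [Fintype F] [Finite K] {γ : K[X]}
    (hγ : Irreducible γ) (f : K[X]) :
    ∃ h : K[X], h.natDegree < γ.natDegree ∧ γ ∣ f - h ^ Fintype.card F := by
  have := Fact.mk hγ
  have : Module.Finite K (AdjoinRoot γ) := (AdjoinRoot.powerBasis hγ.ne_zero).finite
  have : Finite (AdjoinRoot γ) := Module.finite_of_finite K
  have hinj : Function.Injective (FiniteField.frobeniusAlgHom F (AdjoinRoot γ)) :=
    (FiniteField.frobeniusAlgHom F (AdjoinRoot γ)).toRingHom.injective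
  obtain ⟨t, ht⟩ := Finite.surjective_of_injective hinj (AdjoinRoot.mk γ f)
  obtain ⟨h, rfl⟩ := AdjoinRoot.mk_surjective t
  refine ⟨h % γ, natDegree_mod_lt h hγ.natDegree_pos.ne', ?_⟩
  have h1 : γ ∣ f - h ^ Fintype.card F := by
    rw [← AdjoinRoot.mk_eq_mk, ← ht, map_pow]
    rfl
  have h2 : γ ∣ h - h % γ := ⟨h / γ, by rw [sub_eq_iff_eq_add, EuclideanDomain.div_add_mod]⟩
  have h3 := h2.trans (sub_dvd_pow_sub_pow h (h % γ) (Fintype.card F))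
  simpa using dvd_add h1 h3

theorem isCoprime_X_pow_card_sub_X [Fintype K] {γ : K[X]} (hγ : Irreducible γ)
    (h1 : 1 < γ.natDegree) : IsCoprime γ (X ^ Fintype.card K - X) := by
  refine (EuclideanDomain.dvd_or_coprime γ _ hγ).resolve_left fun hd => ?_
  have hs : (X ^ Fintype.card K - X : K[X]).Splits := by
    rw [splits_iff_card_roots, FiniteField.roots_X_pow_card_sub_X,
      FiniteField.X_pow_card_sub_X_natDegree_eq K Fintype.one_lt_card]
    exact Finset.card_univ
  have hs' : γ.Splits :=
    hs.of_dvd (FiniteField.X_pow_card_sub_X_ne_zero K Fintype.one_lt_card) hd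
  exact h1.ne' (natDegree_eq_of_degree_eq_some (hs'.degree_eq_one_of_irreducible hγ))

theorem eval_ne_zero_of_irreducible {γ : K[X]} (hγ : Irreducible γ) (h1 : 1 < γ.natDegree)
    (a : K) : γ.eval a ≠ 0 := fun h0 =>
  h1.ne' (natDegree_eq_of_degree_eq_some (degree_eq_one_of_irreducible_of_root hγ h0))

/-! ### Raising the exponent of the Goppa polynomial -/

section Raise

variable [Fintype ι] {x : ι → K} {γ : K[X]} {c : ι → F}

theorem sum_eq_zero_of_dvd (hx : ∀ i, γ.eval (x i) ≠ 0) (hr : 0 < γ.natDegree) {m : ℕ}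
    (hm : 0 < m) (hc : c ∈ alternant F (γ.natDegree * m) x fun i => (γ.eval (x i) ^ m)⁻¹)
    {f : K[X]} (hd : γ ∣ f) (hf : f.natDegree < γ.natDegree * (m + 1)) :
    ∑ i, algebraMap F K (c i) * ((γ.eval (x i) ^ (m + 1))⁻¹ * f.eval (x i)) = 0 := by
  obtain ⟨g, rfl⟩ := hd
  rcases eq_or_ne g 0 with rfl | hg
  · simp
  have hg' : g.natDegree < γ.natDegree * m := by
    rw [natDegree_mul (ne_zero_of_natDegree_gt hr) hg] at hf
    linarith
  rw [← (mem_alternant_iff (Nat.mul_pos hr hm)).1 hc g hg']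
  refine Finset.sum_congr rfl fun i _ => ?_
  have := hx i
  rw [eval_mul]
  field_simp
  ring

theorem sum_eq_sum_of_dvd_sub (hx : ∀ i, γ.eval (x i) ≠ 0) (hr : 0 < γ.natDegree) {m : ℕ}
    (hm : 0 < m) (hc : c ∈ alternant F (γ.natDegree * m) x fun i => (γ.eval (x i) ^ m)⁻¹)
    {f g : K[X]} (hd : γ ∣ f - g) (hf : f.natDegree < γ.natDegree * (m + 1))
    (hg : g.natDegree < γ.natDegree * (m + 1)) :
    ∑ i, algebraMap F K (c i) * ((γ.eval (x i) ^ (m + 1))⁻¹ * f.eval (x i)) =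
      ∑ i, algebraMap F K (c i) * ((γ.eval (x i) ^ (m + 1))⁻¹ * g.eval (x i)) := by
  have h := sum_eq_zero_of_dvd hx hr hm hc hd
    ((natDegree_sub_le f g).trans_lt (max_lt hf hg))
  simpa only [eval_sub, mul_sub, Finset.sum_sub_distrib, sub_eq_zero] using h

variable [Fintype F] [Finite K]

/-- The nontrivial inclusion of the identity `𝒢(x, γ ^ (q - 1)) = 𝒢(x, γ ^ q)` of Sugiyama, Kasahara,
Hirasawa and Namekawa for wild Goppa codes. -/
theorem mem_alternant_pow_card (hγ : Irreducible γ) (hx : ∀ i, γ.eval (x i) ≠ 0)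
    (hc : c ∈ alternant F (γ.natDegree * (Fintype.card F - 1)) x
      fun i => (γ.eval (x i) ^ (Fintype.card F - 1))⁻¹) :
    c ∈ alternant F (γ.natDegree * Fintype.card F) x
      fun i => (γ.eval (x i) ^ Fintype.card F)⁻¹ := by
  have hr := hγ.natDegree_pos
  obtain ⟨m, hm⟩ : ∃ m, Fintype.card F = m + 2 :=
    Nat.exists_eq_add_of_le' (Fintype.one_lt_card (α := F))
  have hm1 : Fintype.card F - 1 = m + 1 := by omega
  rw [hm1] at hc
  rw [mem_alternant_iff (Nat.mul_pos hr Fintype.card_pos)]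
  intro f hf
  obtain ⟨h, hh, hd⟩ := exists_natDegree_lt_dvd_sub_pow_card (F := F) hγ f
  have hS := sum_mul_pow_card c fun i => (γ.eval (x i))⁻¹ * h.eval (x i)
  have h0 : ∑ i, algebraMap F K (c i) * ((γ.eval (x i))⁻¹ * h.eval (x i)) = 0 := by
    have hdeg : (h * γ ^ m).natDegree < γ.natDegree * (m + 1) := by
      have h1 := natDegree_mul_le (p := h) (q := γ ^ m)
      rw [natDegree_pow] at h1
      linarith
    rw [← (mem_alternant_iff (Nat.mul_pos hr m.succ_pos)).1 hc _ hdeg]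
    refine Finset.sum_congr rfl fun i _ => ?_
    have := hx i
    rw [eval_mul, eval_pow]
    field_simp
    ring
  rw [h0, zero_pow Fintype.card_ne_zero] at hS
  rw [hm] at hf hd hS ⊢
  rw [sum_eq_sum_of_dvd_sub hx hr m.succ_pos hc hd hf, hS]
  · simp only [eval_pow, mul_pow, inv_pow]
  · rw [natDegree_pow, mul_comm]
    gcongr

/-- The nontrivial inclusion of the identity `𝒢(x, γ ^ q) = 𝒢(x, γ ^ (q + 1))`, which is special to
quadratic extensions: it uses that `γ(x_i) ^ (q + 1)` is a norm. -/
theorem mem_alternant_pow_card_add_one (hK : Module.finrank F K = 2) (hγ : Irreducible γ)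
    (hr : 1 < γ.natDegree) (hx : ∀ i, γ.eval (x i) ≠ 0)
    (hc : c ∈ alternant F (γ.natDegree * Fintype.card F) x
      fun i => (γ.eval (x i) ^ Fintype.card F)⁻¹) :
    c ∈ alternant F (γ.natDegree * (Fintype.card F + 1)) x
      fun i => (γ.eval (x i) ^ (Fintype.card F + 1))⁻¹ := by
  have := Fintype.ofFinite K
  have hr0 : 0 < γ.natDegree := by omega
  have hq0 : 0 < Fintype.card F := Fintype.card_pos
  have hcard : Fintype.card K = Fintype.card F ^ 2 := by rw [Module.card_eq_pow_finrank (K := F), hK]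
  set q := Fintype.card F with hq
  have hfrob (a : K) : (a ^ q) ^ q = a := by
    rw [← pow_mul, ← sq, ← hcard, FiniteField.pow_card]
  let S (f : K[X]) : K := ∑ i, algebraMap F K (c i) * ((γ.eval (x i) ^ (q + 1))⁻¹ * f.eval (x i))
  have hS_congr {f g : K[X]} (hd : γ ∣ f - g) (hf : f.natDegree < γ.natDegree * (q + 1))
      (hg : g.natDegree < γ.natDegree * (q + 1)) : S f = S g :=
    sum_eq_sum_of_dvd_sub hx hr0 hq0 hc hd hf hg
  have hS_frob (f g : K[X]) (hfg : ∀ a, g.eval a = f.eval a ^ q) : S f ^ q = S g := by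
    rw [sum_mul_pow_card]
    refine Finset.sum_congr rfl fun i _ => ?_
    rw [hfg, mul_pow, inv_pow, pow_succ, mul_pow, hfrob, mul_comm (γ.eval (x i))]
  rw [mem_alternant_iff (by positivity)]
  intro f hf
  change S f = 0
  obtain ⟨a, b, hab⟩ := isCoprime_X_pow_card_sub_X hγ hr
  rw [hcard] at hab
  obtain ⟨h, hh, hd⟩ := exists_natDegree_lt_dvd_sub_pow_card (F := F) hγ (f * b)
  rw [← hq] at hd
  have hρ : (h * X ^ q % γ).natDegree < γ.natDegree := natDegree_mod_lt _ hr0.ne'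
  set ρ := h * X ^ q % γ with hρ_def
  have hd1 : γ ∣ h * X ^ q - ρ :=
    ⟨h * X ^ q / γ, by rw [sub_eq_iff_eq_add, hρ_def, EuclideanDomain.div_add_mod]⟩
  -- The next two facts together: `f ≡ h ^ q * (X ^ q ^ 2 - X) ≡ ρ ^ q - h ^ q * X` modulo `γ`.
  have hd2 : γ ∣ h ^ q * X ^ q ^ 2 - ρ ^ q := by
    refine hd1.trans ?_
    convert sub_dvd_pow_sub_pow (h * X ^ q) ρ q using 1
    rw [mul_pow, ← pow_mul, sq]
  have hd3 : γ ∣ f - (ρ ^ q - h ^ q * X) := by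
    have : f - (ρ ^ q - h ^ q * X) = γ * (f * a) + (f * b - h ^ q) * (X ^ q ^ 2 - X) +
        (h ^ q * X ^ q ^ 2 - ρ ^ q) := by
      linear_combination -f * hab
    rw [this]
    exact dvd_add (dvd_add (dvd_mul_right _ _) (hd.mul_right _)) hd2
  have hdρ : (ρ ^ q).natDegree < γ.natDegree * (q + 1) := by
    rw [natDegree_pow]
    nlinarith
  have hdh : (h ^ q * X).natDegree < γ.natDegree * (q + 1) := by
    have h1 := natDegree_mul_le (p := h ^ q) (q := X)
    rw [natDegree_pow, natDegree_X] at h1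
    nlinarith
  have hdX : (h * X ^ q).natDegree < γ.natDegree * (q + 1) := by
    have h1 := natDegree_mul_le (p := h) (q := X ^ q)
    rw [natDegree_X_pow] at h1
    nlinarith
  have hS_sub : S (ρ ^ q - h ^ q * X) = S (ρ ^ q) - S (h ^ q * X) := by
    simp only [S, eval_sub, mul_sub, Finset.sum_sub_distrib]
  rw [hS_congr hd3 hf ((natDegree_sub_le _ _).trans_lt (max_lt hdρ hdh)), hS_sub,
    ← hS_frob ρ (ρ ^ q) (by simp), ← hS_frob (h * X ^ q) (h ^ q * X) (by simp [mul_pow, hfrob]),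
    hS_congr hd1 hdX (by nlinarith), sub_self]

theorem mem_alternant_of_mem_goppa (hK : Module.finrank F K = 2) (hγ : Irreducible γ)
    (hr : 1 < γ.natDegree) (hc : c ∈ goppa F x (γ ^ (Fintype.card F - 1))) :
    c ∈ alternant F (γ.natDegree * (Fintype.card F + 1)) x
      fun i => (γ.eval (x i) ^ (Fintype.card F + 1))⁻¹ := by
  have hx (i : ι) : γ.eval (x i) ≠ 0 := eval_ne_zero_of_irreducible hγ hr (x i)
  refine mem_alternant_pow_card_add_one hK hγ hr hx (mem_alternant_pow_card hγ hx ?_)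
  simpa only [goppa, natDegree_pow, eval_pow, mul_comm] using hc

end Raise

end GoppaInclusion

/-! ### Conjugates and permutations of the pairs -/

theorem eq_or_eq_pow_card_of_minpoly_eq {F K : Type*} [Field F] [Fintype F] [Field K] [Algebra F K]
    [Finite K] (hK : Module.finrank F K = 2) {a b : K} (h : minpoly F a = minpoly F b) :
    a = b ∨ a = b ^ Fintype.card F := by
  obtain ⟨s, rfl⟩ := isConjRoot_iff_exists_algEquiv.1 (isConjRoot_def.2 h)
  obtain ⟨⟨i, hi⟩, rfl⟩ := (FiniteField.bijective_frobeniusAlgEquivOfAlgebraic_pow F K).2 s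
  rw [hK] at hi
  interval_cases i
  · exact .inl rfl
  · exact .inr (by simp)

theorem exists_mem_pairSwaps (l₁ l₂ l₃ : ℕ) (s : Finset (Fin l₂ ⊕ Fin l₃)) :
    ∃ τ ∈ pairSwaps l₁ l₂ l₃, (∀ i, τ (.inl i) = .inl i) ∧
      ∀ j b, τ (.inr (j, b)) = .inr (j, if j ∈ s then Equiv.swap 0 1 b else b) := by
  classical
  induction s using Finset.induction_on with
  | empty => exact ⟨1, one_mem _, by simp, by simp⟩
  | insert a s ha ih =>
    obtain ⟨τ, hτ, hl, hr⟩ := ih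
    refine ⟨Equiv.swap (.inr (a, 0)) (.inr (a, 1)) * τ,
      mul_mem (Subgroup.subset_closure ⟨a, rfl⟩) hτ, fun i => ?_, fun j b => ?_⟩
    · rw [Equiv.Perm.mul_apply, hl, Equiv.swap_apply_of_ne_of_ne] <;> simp
    · rw [Equiv.Perm.mul_apply, hr]
      rcases eq_or_ne j a with rfl | hj
      · rw [if_neg ha, if_pos (Finset.mem_insert_self _ _)]
        fin_cases b <;> simp
      · rw [Equiv.swap_apply_of_ne_of_ne (by simp [hj]) (by simp [hj])]
        simp [hj]

section Extension

variable {F K : Type*} [Field F] [Field K] [Algebra F K] {l₁ l₂ l₃ : ℕ}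

theorem IsSorted.extSupport_conj {q : ℕ} {y : SortedPos l₁ l₂ l₃ → K} (hy : IsSorted F q y)
    (j : Fin l₂ ⊕ Fin l₃) :
    extSupport q y (.inr (j, 1)) = extSupport q y (.inr (j, 0)) ^ q := by
  rcases j with i | i
  · exact hy.v_conj i
  · simp [extSupport]

/-- Up to an exchange of the entries of some pairs, a Galois variant is the original vector. -/
theorem IsGaloisVariant.exists_mem_pairSwaps [Fintype F] [Finite K] (hK : Module.finrank F K = 2)
    {y : SortedPos l₁ l₂ l₃ → K} (hy : IsSorted F (Fintype.card F) y) {z : ExtPos l₁ l₂ l₃ → K}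
    (hz : IsGaloisVariant F (Fintype.card F) (extSupport (Fintype.card F) y) z) :
    ∃ τ ∈ pairSwaps l₁ l₂ l₃, ∀ p, z (τ p) = extSupport (Fintype.card F) y p := by
  classical
  have := Fintype.ofFinite K
  have hfrob (a : K) : (a ^ Fintype.card F) ^ Fintype.card F = a := by
    rw [← pow_mul, ← sq, ← hK, ← Module.card_eq_pow_finrank, FiniteField.pow_card]
  set e := extSupport (Fintype.card F) y with he
  obtain ⟨τ, hτ, hl, hr⟩ := _root_.exists_mem_pairSwaps l₁ l₂ l₃
    (Finset.univ.filter fun j => z (.inr (j, 0)) ≠ e (.inr (j, 0)))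
  refine ⟨τ, hτ, ?_⟩
  rintro (i | ⟨j, b⟩)
  · rw [hl]
    obtain ⟨u, hu⟩ := hy.u_mem i
    have hu : e (.inl i) = algebraMap F K u := hu.symm
    rcases eq_or_eq_pow_card_of_minpoly_eq hK (hz.minpoly_eq (.inl i)) with h | h
    · exact h
    · rw [h, hu, ← map_pow, FiniteField.pow_card]
  · rw [hr]
    have hej := hy.extSupport_conj j
    rw [← he] at hej
    have hzj := hz.conj j
    by_cases hj : z (.inr (j, 0)) = e (.inr (j, 0))
    · rw [if_neg (by simpa using hj)]
      fin_cases b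
      · exact hj
      · exact hzj.trans (hj ▸ hej.symm)
    · have h := (eq_or_eq_pow_card_of_minpoly_eq hK (hz.minpoly_eq (.inr (j, 0)))).resolve_left hj
      rw [if_pos (by simpa using hj)]
      fin_cases b
      · simp [hzj, h, hfrob]
      · simp [hej, h]

/-- Summation over the extended positions reduces to the original ones when the row is extended by
zeros. -/
theorem sum_vecMul_extMatrix_mul {κ : Type*} [Fintype κ] (q : ℕ)
    (G : Matrix κ (SortedPos l₁ l₂ l₃) F) (v : κ → F) (y : SortedPos l₁ l₂ l₃ → K) (g : K → K) :
    ∑ p, algebraMap F K (Matrix.vecMul v (extMatrix G) p) * g (extSupport q y p) =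
      ∑ p, algebraMap F K (Matrix.vecMul v G p) * g (y p) := by
  simp [Fintype.sum_sum_type, Fintype.sum_prod_type, Matrix.vecMul, dotProduct, extMatrix,
    extSupport, -map_sum]

end Extension

theorem theoremB {F K : Type*} [Field F] [Fintype F] [Field K] [Algebra F K]
    (q : ℕ) (hq : Fintype.card F = q) (hK : Module.finrank F K = 2)
    -- the secret key: a support `x` and an irreducible `γ` of degree `r > 1`
    (n : ℕ) (x : Fin n → K) (hx : Function.Injective x)
    (γ : Polynomial K) (hγ : Irreducible γ) (r : ℕ) (hr : γ.natDegree = r) (hr1 : 1 < r)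
    -- a generator matrix `G` of the public wild Goppa code
    (k : ℕ) (G : Matrix (Fin k) (Fin n) F) (hG : rowCode G = goppa F x (γ ^ (q - 1)))
    -- a permutation `σ` that sorts the support
    (l₁ l₂ l₃ : ℕ) (σ : Fin n ≃ SortedPos l₁ l₂ l₃) (hσ : IsSorted F q (x ∘ σ.symm))
    -- a vector that agrees with the extended sorted support up to Galois conjugation
    (x' : ExtPos l₁ l₂ l₃ → K) (hx' : IsGaloisVariant F q (extSupport q (x ∘ σ.symm)) x') :
    ∃ (M D : Matrix (ExtPos l₁ l₂ l₃) (ExtPos l₁ l₂ l₃) F),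
      ∃ τ ∈ pairSwaps l₁ l₂ l₃,
        M = Equiv.Perm.permMatrix F τ * D ∧ D.IsDiag ∧ IsUnit D ∧
        codeMul (rowCode (extMatrix (G.submatrix id σ.symm))) M ≤
          alternant F (r * (q + 1)) x' (fun _ => 1) := by
  subst hq hr
  have : Module.Finite F K := Module.finite_of_finrank_pos (by omega)
  have : Finite K := Module.finite_of_finite F
  obtain ⟨τ, hτ, hxτ⟩ := hx'.exists_mem_pairSwaps hK hσ
  have hnorm (a : K) : algebraMap F K (Algebra.norm F a) = a ^ (Fintype.card F + 1) := by
    simp [FiniteField.algebraMap_norm_eq_prod_pow, hK, Finset.prod_range_succ, pow_succ, mul_comm]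
  -- `D` carries the multiplier `γ(x') ^ (-(q + 1))`, which is a vector over `F`.
  let d : ExtPos l₁ l₂ l₃ → F := fun p => (Algebra.norm F (γ.eval (x' p)))⁻¹
  refine ⟨_, Matrix.diagonal d, τ, hτ, rfl, Matrix.isDiag_diagonal d, ?_, ?_⟩
  · rw [Matrix.isUnit_iff_isUnit_det, Matrix.det_diagonal, isUnit_iff_ne_zero]
    exact Finset.prod_ne_zero_iff.2 fun p _ => inv_ne_zero (Algebra.norm_ne_zero_iff.2
      (eval_ne_zero_of_irreducible hγ hr1 _))
  rintro _ ⟨_, ⟨v, rfl⟩, rfl⟩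
  rw [mem_alternant_iff (by positivity)]
  intro p hp
  have hc : Matrix.vecMul v G ∈ goppa F x (γ ^ (Fintype.card F - 1)) := hG ▸ ⟨v, rfl⟩
  have hsum := (mem_alternant_iff (by positivity)).1
    (mem_alternant_of_mem_goppa hK hγ hr1 hc) p hp
  rw [← hsum]
  have hsort (g : K → K) :
      ∑ i, algebraMap F K (Matrix.vecMul v G i) * g (x i) =
        ∑ s, algebraMap F K (Matrix.vecMul v (G.submatrix id σ.symm) s) * g ((x ∘ σ.symm) s) :=
    (Equiv.sum_comp σ.symm fun i => algebraMap F K (Matrix.vecMul v G i) * g (x i)).symm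
  rw [hsort fun a => (γ.eval a ^ (Fintype.card F + 1))⁻¹ * p.eval a,
    ← sum_vecMul_extMatrix_mul (Fintype.card F) _ v (x ∘ σ.symm)
      fun a => (γ.eval a ^ (Fintype.card F + 1))⁻¹ * p.eval a, ← Equiv.sum_comp τ]
  refine Finset.sum_congr rfl fun s _ => ?_
  simp only [Matrix.vecMulLinear_apply, ← Matrix.vecMul_vecMul, Matrix.vecMul_diagonal,
    Matrix.vecMul_permMatrix, Function.comp_apply, Equiv.symm_apply_apply, map_mul, d, map_inv₀,
    hnorm, hxτ]
  ring
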